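/- Let $\Gamma$ be a finite simple connected graph of diameter $D\ge 3$. For a real number $b$ put $[j]=\frac{b^j-1}{b-1}$ if $b\neq 1$ and $[j]=j$ if $b=1$. Suppose that $\Gamma$ is a distance-regular graph with classical parameters $(D,b,\alpha,\beta)$, where $b,\alpha,\beta$ are real and $b\ge 2$; that is, for any two vertices $x,y$ at distance $i$, the number of neighbours of $y$ at distance $i+1$ from $x$ is a number $b_i$, and the number of neighbours of $y$ at distance $i-1$ from $x$ is a number $c_i$, both depending only on $i$, with $$b_i=([D]-[i])(\beta-\alpha[i])\quad(0\le i\le D-1),\qquad c_i=[i](1+\alpha[i-1])\quad(1\le i\le D).$$ Let $r=[D]$. If $$\beta\ \ge\ \max\left\{\frac{2b+4}{2b+3}\,r(b+2)(\alpha b+b+\alpha),\ \frac{2b+4}{2b+3}\,r\bigl((b+1)(b^2+b+2)-3\bigr)\right\},$$ then $\Gamma$ is geometric: there is a set $\mathcal C$ of Delsarte cliques of $\Gamma$ such that every edge of $\Gamma$ lies in a unique member of $\mathcal C$. Here a Delsarte clique is a clique with exactly $1+\frac{k}{-\theta_{\min}}$ vertices, where $k$ is the valency of $\Gamma$ and $\theta_{\min}$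 is the smallest eigenvalue of its adjacency matrix. -/

import Mathlib

/-- The number `[j]` attached to the base `b`: `[j] = (b ^ j - 1) / (b - 1)` if `b ≠ 1`, and
`[j] = j` if `b = 1`. -/
noncomputable def gaussNumber (b : ℝ) (j : ℕ) : ℝ :=
  if b = 1 then (j : ℝ) else (b ^ j - 1) / (b - 1)

/-- `G` is a distance-regular graph with intersection numbers `bs i`, `cs i`: it is connected, and
for all vertices `x`, `y` at distance `i`, exactly `bs i` neighbours of `y` are at distance `i + 1`
from `x` and exactly `cs i` neighbours of `y` are at distance `i - 1` from `x` (none if `i = 0`). -/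
structure HasIntersectionNumbers {V : Type*} [Fintype V] [DecidableEq V] (G : SimpleGraph V)
    [DecidableRel G.Adj] (bs cs : ℕ → ℕ) : Prop where
  connected : G.Connected
  card_succ : ∀ x y : V,
    ((G.neighborFinset y).filter fun z => G.dist x z = G.dist x y + 1).card = bs (G.dist x y)
  card_pred : ∀ x y : V,
    ((G.neighborFinset y).filter fun z => G.dist x z + 1 = G.dist x y).card = cs (G.dist x y)

/-- `G` is a distance-regular graph. -/
def IsDistanceRegular {V : Type*} [Fintype V] [DecidableEq V] (G : SimpleGraph V)
    [DecidableRel G.Adj] : Prop :=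
  ∃ bs cs : ℕ → ℕ, HasIntersectionNumbers G bs cs

/-- `G` is a distance-regular graph with classical parameters `(D, b, α, β)`. -/
def HasClassicalParameters {V : Type*} [Fintype V] [DecidableEq V] (G : SimpleGraph V)
    [DecidableRel G.Adj] (D : ℕ) (b α β : ℝ) : Prop :=
  G.diam = D ∧ ∃ bs cs : ℕ → ℕ, HasIntersectionNumbers G bs cs ∧
    (∀ i : ℕ, i < D →
      (bs i : ℝ) = (gaussNumber b D - gaussNumber b i) * (β - α * gaussNumber b i)) ∧
    (∀ i : ℕ, 1 ≤ i → i ≤ D →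
      (cs i : ℝ) = gaussNumber b i * (1 + α * gaussNumber b (i - 1)))

/-- `θ` is the smallest eigenvalue of (the adjacency matrix of) the graph `G`. -/
def IsSmallestEigenvalue {V : Type*} [Fintype V] [DecidableEq V] (G : SimpleGraph V)
    [DecidableRel G.Adj] (θ : ℝ) : Prop :=
  IsLeast {t : ℝ | Module.End.HasEigenvalue (Matrix.toLin' (G.adjMatrix ℝ)) t} θ

/-- `C` is a Delsarte clique of the regular graph `G`: a clique with exactly `1 + k / (-θ)`
vertices, where `k` is the valency and `θ` the smallest eigenvalue of `G`. -/
def IsDelsarteClique {V : Type*} [Fintype V] [DecidableEq V] (G : SimpleGraph V)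
    [DecidableRel G.Adj] (C : Finset V) : Prop :=
  G.IsClique (C : Set V) ∧ ∃ (k : ℕ) (θ : ℝ), G.IsRegularOfDegree k ∧
    IsSmallestEigenvalue G θ ∧ (C.card : ℝ) = 1 + (k : ℝ) / (-θ)

/-- `G` is a geometric distance-regular graph: there is a set `𝒞` of Delsarte cliques such that
every edge lies in a unique member of `𝒞`. -/
def IsGeometric {V : Type*} [Fintype V] [DecidableEq V] (G : SimpleGraph V)
    [DecidableRel G.Adj] : Prop :=
  IsDistanceRegular G ∧ ∃ 𝒞 : Set (Finset V), (∀ C ∈ 𝒞, IsDelsarteClique G C) ∧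
    ∀ x y : V, G.Adj x y → ∃! C : Finset V, C ∈ 𝒞 ∧ x ∈ C ∧ y ∈ C

/-! ### Large cliques through edges, by counting common neighbours -/

section Lines

variable {V : Type*} [Fintype V] [DecidableEq V] {G : SimpleGraph V} [DecidableRel G.Adj]

/-! Write λ for the number of common neighbours of an edge, and `A` for the set of these neighbours.
Two nonadjacent vertices of `A` share at most `c₂` neighbours, so between them they miss much of
`A`, while `A` contains few nonadjacent pairs (`sum_nonadjacent_le`). Hence the vertices of `A` that
miss little form a clique, which together with the edge has more than (λ + 2 + c₂) / 2 vertices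
(`exists_large_clique`). Two maximal cliques of this size cannot share an edge, so such cliques, the
lines, cover each edge once (`exists_lines`).

An explicit alternating eigenvector and a Perron-type comparison show that the smallest eigenvalue
is `-r` (`HasIntersectionNumbers.neg_le_eigenvalue`). Since the valency is `r * β`, it remains to
show that every line has `1 + β` vertices (`HasIntersectionNumbers.card_line_eq`), which is a rank
count. The projection onto the eigenspace `E` of `-r` has a constant diagonal entry φ₀, so dim E =
|V| φ₀. Vectors with zero sum on every line lie in `E`, because `A + r` (now with `A` the adjacency
matrix) is positive semidefinite. There are fewer than |V| / 2 lines, since lines are long and few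
pass through a vertex; so φ₀ > 1/2.

Suppose the set `𝓝` of lines below the Delsarte bound is nonempty, with union `B`. A vector of `E`
with zero sums on `𝓝` has zero sum on every line, since lines attaining the bound are orthogonal to
`E`; it then vanishes on `B`, where more than `r` lines meet at each vertex. So the diagonal of the
projection on `B` comes from a subspace of dimension at most |𝓝|, and |B| φ₀ ≤ |𝓝| < |B| / 2, a
contradiction. -/

/-- In a graph in which nonadjacent vertices have at most `μ` common neighbours, a vertex outside
a maximal clique has at most `μ` neighbours in that clique. -/
theorem card_neighborFinset_inter_le_of_maximal_clique {μ : ℕ}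
    (hμ : ∀ x y, x ≠ y → ¬ G.Adj x y → (G.neighborFinset x ∩ G.neighborFinset y).card ≤ μ)
    {L : Finset V} (hL : Maximal (fun C : Finset V => G.IsClique (C : Set V)) L) {z : V}
    (hz : z ∉ L) : (G.neighborFinset z ∩ L).card ≤ μ := by
  have hw : ∃ w ∈ L, ¬ G.Adj z w := by
    by_contra! hcon
    have hcl : G.IsClique ((insert z L : Finset V) : Set V) := by
      rw [Finset.coe_insert]
      exact hL.prop.insert fun w hw _ => hcon w hw
    exact hz (hL.le_of_ge hcl (Finset.subset_insert z L) (Finset.mem_insert_self z L))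
  obtain ⟨w, hwL, hzw⟩ := hw
  have hne : z ≠ w := fun h => hz (h ▸ hwL)
  refine (Finset.card_le_card fun v hv => ?_).trans (hμ z w hne hzw)
  rw [Finset.mem_inter] at hv ⊢
  refine ⟨hv.1, ?_⟩
  rw [SimpleGraph.mem_neighborFinset] at hv ⊢
  refine hL.prop hwL hv.2 fun h => hzw ?_
  rw [h]
  exact hv.1

/-- If two maximal cliques share an edge and are both large, then they coincide. -/
theorem maximal_clique_unique_of_edge {lam μ : ℕ}
    (hlam : ∀ x y, G.Adj x y → (G.neighborFinset x ∩ G.neighborFinset y).card = lam)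
    (hμ : ∀ x y, x ≠ y → ¬ G.Adj x y → (G.neighborFinset x ∩ G.neighborFinset y).card ≤ μ)
    {L L' : Finset V} (hL : Maximal (fun C : Finset V => G.IsClique (C : Set V)) L)
    (hL' : Maximal (fun C : Finset V => G.IsClique (C : Set V)) L')
    (hLc : lam + 2 + μ < 2 * L.card) (hLc' : lam + 2 + μ < 2 * L'.card)
    {x y : V} (hxy : G.Adj x y) (hx : x ∈ L) (hy : y ∈ L) (hx' : x ∈ L') (hy' : y ∈ L') :
    L = L' := by
  by_contra hne
  have hsub : ¬ L' ⊆ L := fun h => hne (hL'.eq_of_le hL.prop h).symm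
  obtain ⟨z, hz', hz⟩ := Finset.not_subset.1 hsub
  -- Bounding the intersection by `μ` and the union by `lam + 2` gives |L| + |L'| ≤ lam + 2 + μ,
  -- against the sizes assumed.
  have hinter : (L ∩ L').card ≤ μ := by
    refine (Finset.card_le_card fun v hv => ?_).trans
      (card_neighborFinset_inter_le_of_maximal_clique hμ hL hz)
    rw [Finset.mem_inter] at hv ⊢
    refine ⟨(SimpleGraph.mem_neighborFinset ..).2 (hL'.prop hz' hv.2 ?_), hv.1⟩
    rintro rfl
    exact hz hv.1
  have hunion : (L ∪ L').card ≤ lam + 2 := by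
    have hsub : L ∪ L' ⊆ (G.neighborFinset x ∩ G.neighborFinset y) ∪ {x, y} := by
      intro v hv
      by_cases h1 : v = x
      · simp [h1]
      by_cases h2 : v = y
      · simp [h2]
      rw [Finset.mem_union, Finset.mem_inter, SimpleGraph.mem_neighborFinset,
        SimpleGraph.mem_neighborFinset]
      left
      rcases Finset.mem_union.1 hv with h | h
      · exact ⟨hL.prop hx h (Ne.symm h1), hL.prop hy h (Ne.symm h2)⟩
      · exact ⟨hL'.prop hx' h (Ne.symm h1), hL'.prop hy' h (Ne.symm h2)⟩
    calc (L ∪ L').card ≤ _ := Finset.card_le_card hsub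
      _ ≤ _ := Finset.card_union_le _ _
      _ ≤ lam + 2 := by
        rw [hlam x y hxy]
        exact Nat.add_le_add_left Finset.card_le_two _
  have := Finset.card_union_add_card_inter L L'
  omega

/-- Inside the common neighbourhood of an edge, there are few ordered pairs of distinct nonadjacent
vertices. -/
theorem sum_nonadjacent_le {k lam μ : ℕ} (hk : G.IsRegularOfDegree k)
    (hlam : ∀ x y, G.Adj x y → (G.neighborFinset x ∩ G.neighborFinset y).card = lam)
    (hμ : ∀ x y, x ≠ y → ¬ G.Adj x y → (G.neighborFinset x ∩ G.neighborFinset y).card ≤ μ)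
    {x y : V} (hxy : G.Adj x y) :
    (∑ z ∈ G.neighborFinset x ∩ G.neighborFinset y,
      (((G.neighborFinset x ∩ G.neighborFinset y) \ G.neighborFinset z).card - 1 : ℤ)) ≤
      (k - 1 - lam) * (μ - 1) := by
  set A := G.neighborFinset x ∩ G.neighborFinset y with hA
  set B := (G.neighborFinset x \ G.neighborFinset y).erase y with hB
  have hBcard : (B.card : ℤ) = k - 1 - lam := by
    have hmem : y ∈ G.neighborFinset x \ G.neighborFinset y := by simp [hxy]
    have h1 := Finset.card_erase_add_one hmem
    have h2 := Finset.card_sdiff_add_card_inter (G.neighborFinset x) (G.neighborFinset y)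
    have h3 := hk x
    rw [← SimpleGraph.card_neighborFinset_eq_degree] at h3
    have h4 := hlam x y hxy
    rw [← hA] at h2 h4
    rw [← hB] at h1
    omega
  -- The edge `xz` also has `lam = #A` common neighbours, so each vertex of `A` other than `z`
  -- missed by `z` is made up for by a neighbour of `z` in `B`. The sum thus counts edges between
  -- `A` and `B`.
  have hnd : ∀ z ∈ A, ((A \ G.neighborFinset z).card - 1 : ℤ) =
      (B.filter fun w => G.Adj z w).card := by
    intro z hz
    have hzx : G.Adj x z := by simpa using (Finset.mem_inter.1 hz).1
    have hzy : G.Adj y z := by simpa using (Finset.mem_inter.1 hz).2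
    have hdec : G.neighborFinset x ∩ G.neighborFinset z =
        insert y ((A ∩ G.neighborFinset z) ∪ B.filter fun w => G.Adj z w) := by
      ext w
      simp only [hA, hB, Finset.mem_inter, Finset.mem_insert, Finset.mem_union, Finset.mem_filter,
        Finset.mem_erase, Finset.mem_sdiff, SimpleGraph.mem_neighborFinset]
      constructor
      · rintro ⟨h1, h2⟩
        by_cases h3 : w = y
        · exact Or.inl h3
        · by_cases h4 : G.Adj y w
          · exact Or.inr (Or.inl ⟨⟨h1, h4⟩, h2⟩)
          · exact Or.inr (Or.inr ⟨⟨h3, h1, h4⟩, h2⟩)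
      · rintro (rfl | ⟨⟨h1, _⟩, h2⟩ | ⟨⟨_, h1, _⟩, h2⟩)
        · exact ⟨hxy, hzy.symm⟩
        · exact ⟨h1, h2⟩
        · exact ⟨h1, h2⟩
    have hc := congrArg Finset.card hdec
    rw [hlam x z hzx, Finset.card_insert_of_notMem (by simp [hA, hB]),
      Finset.card_union_of_disjoint] at hc
    · have h2 := Finset.card_sdiff_add_card_inter A (G.neighborFinset z)
      have h4 := hlam x y hxy
      rw [← hA] at h4
      omega
    · rw [Finset.disjoint_left]
      intro w hw hw'
      simp only [hA, hB, Finset.mem_inter, Finset.mem_filter,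
        Finset.mem_erase, Finset.mem_sdiff] at hw hw'
      exact hw'.1.2.2 hw.1.2
  rw [Finset.sum_congr rfl hnd]
  have hswap : ∑ z ∈ A, (B.filter fun w => G.Adj z w).card =
      ∑ w ∈ B, (A.filter fun z => G.Adj z w).card :=
    Finset.sum_card_bipartiteAbove_eq_sum_card_bipartiteBelow (s := A) (t := B) G.Adj
  -- The common neighbour `x` of `y` and `w` lies outside `A`, hence `μ - 1`.
  have hle : ∀ w ∈ B, (((A.filter fun z => G.Adj z w).card : ℕ) : ℤ) ≤ μ - 1 := by
    intro w hw
    simp only [hB, Finset.mem_erase, Finset.mem_sdiff, SimpleGraph.mem_neighborFinset] at hw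
    obtain ⟨hwy, hxw, hyw⟩ := hw
    have hsub : insert x (A.filter fun z => G.Adj z w) ⊆
        G.neighborFinset y ∩ G.neighborFinset w := by
      intro v hv
      simp only [hA, Finset.mem_insert, Finset.mem_filter, Finset.mem_inter,
        SimpleGraph.mem_neighborFinset] at hv ⊢
      rcases hv with rfl | ⟨⟨_, h2⟩, h3⟩
      · exact ⟨hxy.symm, hxw.symm⟩
      · exact ⟨h2, h3.symm⟩
    have h1 := (Finset.card_le_card hsub).trans (hμ y w (Ne.symm hwy) hyw)
    rw [Finset.card_insert_of_notMem (by simp [hA])] at h1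
    omega
  calc (∑ z ∈ A, ((B.filter fun w => G.Adj z w).card : ℤ))
      = ∑ w ∈ B, ((A.filter fun z => G.Adj z w).card : ℤ) := by exact_mod_cast hswap
    _ ≤ ∑ w ∈ B, ((μ : ℤ) - 1) := Finset.sum_le_sum hle
    _ = (k - 1 - lam) * (μ - 1) := by rw [Finset.sum_const, nsmul_eq_mul, hBcard]

/-- Every edge lies in a large clique. -/
theorem exists_large_clique {k lam μ : ℕ} (hk : G.IsRegularOfDegree k)
    (hlam : ∀ x y, G.Adj x y → (G.neighborFinset x ∩ G.neighborFinset y).card = lam)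
    (hμ : ∀ x y, x ≠ y → ¬ G.Adj x y → (G.neighborFinset x ∩ G.neighborFinset y).card ≤ μ)
    (hQ : μ < lam + 2)
    (hQ2 : 4 * ((k : ℤ) - 1 - lam) * (μ - 1) < ((lam : ℤ) + 2 - μ) ^ 2)
    {x y : V} (hxy : G.Adj x y) :
    ∃ C : Finset V, G.IsClique (C : Set V) ∧ x ∈ C ∧ y ∈ C ∧ lam + 2 + μ < 2 * C.card := by
  have hsum := sum_nonadjacent_le hk hlam hμ hxy
  set A := G.neighborFinset x ∩ G.neighborFinset y with hA
  set nd : V → ℤ := fun z => ((A \ G.neighborFinset z).card - 1 : ℤ) with hnd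
  have hAc : A.card = lam := hlam x y hxy
  have hnd0 : ∀ z ∈ A, 0 ≤ nd z := by
    intro z hz
    have : 0 < (A \ G.neighborFinset z).card :=
      Finset.card_pos.2 ⟨z, by simp [hz]⟩
    simp only [hnd]
    omega
  set H := A.filter fun z => 2 * nd z < lam + 2 - μ with hH
  -- Two is saved twice: `z` and `w` are each missed by both, and `x`, `y` are common neighbours of
  -- `z` and `w` outside `A`.
  have hpair : ∀ z ∈ A, ∀ w ∈ A, z ≠ w → ¬ G.Adj z w → (lam : ℤ) + 2 - μ ≤ nd z + nd w := by
    intro z hz w hw hzw hadj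
    have h1 : A ⊆ ((A \ G.neighborFinset z) ∪ (A \ G.neighborFinset w)) ∪
        (A ∩ (G.neighborFinset z ∩ G.neighborFinset w)) := by
      intro v hv
      simp only [Finset.mem_union, Finset.mem_sdiff, Finset.mem_inter]
      tauto
    have h2 := (Finset.card_le_card h1).trans (Finset.card_union_le _ _)
    have h3 := Finset.card_union_add_card_inter (A \ G.neighborFinset z) (A \ G.neighborFinset w)
    have h4 : 2 ≤ ((A \ G.neighborFinset z) ∩ (A \ G.neighborFinset w)).card := by
      rw [← Finset.card_pair hzw]
      refine Finset.card_le_card fun v hv => ?_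
      rw [Finset.mem_insert, Finset.mem_singleton] at hv
      rcases hv with rfl | rfl
      · simp [hz, G.adj_comm w, hadj]
      · simp [hw, hadj]
    have h5 : (A ∩ (G.neighborFinset z ∩ G.neighborFinset w)).card + 2 ≤ μ := by
      refine le_trans ?_ (hμ z w hzw hadj)
      rw [← Finset.card_pair hxy.ne, ← Finset.card_union_of_disjoint]
      · refine Finset.card_le_card fun v hv => ?_
        simp only [hA, Finset.mem_union, Finset.mem_inter, Finset.mem_insert,
          Finset.mem_singleton, SimpleGraph.mem_neighborFinset] at hv hz hw ⊢
        rcases hv with h | rfl | rfl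
        · exact h.2
        · exact ⟨hz.1.symm, hw.1.symm⟩
        · exact ⟨hz.2.symm, hw.2.symm⟩
      · rw [Finset.disjoint_left]
        intro v hv hv'
        simp only [hA, Finset.mem_inter, Finset.mem_insert,
          Finset.mem_singleton, SimpleGraph.mem_neighborFinset] at hv hv'
        rcases hv' with rfl | rfl
        · exact hv.1.1.ne rfl
        · exact hv.1.2.ne rfl
    simp only [hnd]
    omega
  have hcl : G.IsClique (H : Set V) := by
    intro z hz w hw hzw
    by_contra hadj
    rw [Finset.mem_coe, hH, Finset.mem_filter] at hz hw
    have := hpair z hz.1 w hw.1 hzw hadj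
    omega
  refine ⟨insert x (insert y H), ?_, by simp, by simp, ?_⟩
  · rw [Finset.coe_insert, Finset.coe_insert]
    have hHA : ∀ z ∈ H, G.Adj x z ∧ G.Adj y z := by
      intro z hz
      simpa [hA] using (Finset.mem_filter.1 hz).1
    refine (hcl.insert fun z hz _ => (hHA z hz).2).insert fun z hz _ => ?_
    rcases Set.mem_insert_iff.1 hz with rfl | hz
    · exact hxy
    · exact (hHA z hz).1
  · have hcard : (insert x (insert y H)).card = H.card + 2 := by
      rw [Finset.card_insert_of_notMem, Finset.card_insert_of_notMem]
      · simp [hH, hA]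
      · simp [hH, hA, hxy.ne]
    rw [hcard]
    have hsplit := Finset.card_filter_add_card_filter_not (s := A) fun z => 2 * nd z < lam + 2 - μ
    set K := A.filter fun z => ¬ 2 * nd z < lam + 2 - μ with hK
    rw [← hH, hAc] at hsplit
    have hbad : (K.card : ℤ) * (lam + 2 - μ) ≤ 2 * ((k - 1 - lam) * (μ - 1)) := by
      calc (K.card : ℤ) * (lam + 2 - μ) = ∑ z ∈ K, ((lam : ℤ) + 2 - μ) := by
            rw [Finset.sum_const, nsmul_eq_mul]
        _ ≤ ∑ z ∈ K, 2 * nd z := by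
            refine Finset.sum_le_sum fun z hz => ?_
            exact not_lt.1 (Finset.mem_filter.1 hz).2
        _ ≤ ∑ z ∈ A, 2 * nd z := by
            refine Finset.sum_le_sum_of_subset_of_nonneg (Finset.filter_subset _ _) ?_
            intro z hz _
            have := hnd0 z hz
            omega
        _ ≤ 2 * ((k - 1 - lam) * (μ - 1)) := by
            rw [← Finset.mul_sum]
            exact mul_le_mul_of_nonneg_left hsum zero_le_two
    have hQ' : (0 : ℤ) < lam + 2 - μ := by omega
    -- With Q = lam + 2 - μ, Markov's inequality and `hQ2` give |K| Q < Q² / 2.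
    have hlt : 2 * (K.card : ℤ) < lam + 2 - μ := by
      by_contra! hcon
      nlinarith
    omega

/-- If the valency is small compared with the numbers of common neighbours, then there is a family
of large cliques containing every edge exactly once. -/
theorem exists_lines {k lam μ : ℕ} (hk : G.IsRegularOfDegree k)
    (hlam : ∀ x y, G.Adj x y → (G.neighborFinset x ∩ G.neighborFinset y).card = lam)
    (hμ : ∀ x y, x ≠ y → ¬ G.Adj x y → (G.neighborFinset x ∩ G.neighborFinset y).card ≤ μ)
    (hQ : μ < lam + 2)
    (hQ2 : 4 * ((k : ℤ) - 1 - lam) * (μ - 1) < ((lam : ℤ) + 2 - μ) ^ 2) :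
    ∃ 𝓛 : Finset (Finset V),
      (∀ L ∈ 𝓛, G.IsClique (L : Set V) ∧ lam + 2 + μ < 2 * L.card) ∧
      ∀ x y, G.Adj x y → ∃! L, L ∈ 𝓛 ∧ x ∈ L ∧ y ∈ L := by
  classical
  refine ⟨Finset.univ.filter fun L => Maximal (fun C : Finset V => G.IsClique (C : Set V)) L ∧
    lam + 2 + μ < 2 * L.card, ?_, ?_⟩
  · intro L hL
    rw [Finset.mem_filter] at hL
    exact ⟨hL.2.1.prop, hL.2.2⟩
  · intro x y hxy
    obtain ⟨C, hC, hx, hy, hcard⟩ := exists_large_clique hk hlam hμ hQ hQ2 hxy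
    obtain ⟨L, hCL, hL⟩ := Finite.exists_le_maximal (p := fun C : Finset V => G.IsClique (C : Set V)) hC
    have hLc : lam + 2 + μ < 2 * L.card := by
      have := Finset.card_le_card hCL
      omega
    refine ⟨L, ⟨by simp [hL, hLc], hCL hx, hCL hy⟩, ?_⟩
    rintro L' ⟨hL', hx', hy'⟩
    rw [Finset.mem_filter] at hL'
    exact maximal_clique_unique_of_edge hlam hμ hL'.2.1 hL hL'.2.2 hLc hxy hx' hy'
      (hCL hx) (hCL hy)

end Lines

/-! ### Orthogonal projections onto eigenspaces and their diagonals -/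

section Projections

open Module.End in
/-- The orthogonal projection onto an eigenspace of a symmetric operator is a polynomial in that
operator. -/
theorem exists_aeval_eq_starProjection_eigenspace {E : Type*} [NormedAddCommGroup E]
    [InnerProductSpace ℝ E] [FiniteDimensional ℝ E] {T : E →ₗ[ℝ] E} (hT : T.IsSymmetric) (t : ℝ) :
    ∃ p : Polynomial ℝ, ∀ v, (eigenspace T t).starProjection v = Polynomial.aeval T p v := by
  -- The cofactor `q` of the power of `X - t` in the minimal polynomial, normalised to be 1 at `t`,
  -- fixes the eigenspace and kills the other components.
  obtain ⟨q, hq, hdvd⟩ := Polynomial.exists_eq_pow_rootMultiplicity_mul_and_not_dvd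
    (minpoly ℝ T) (minpoly.ne_zero (Algebra.IsIntegral.isIntegral T)) t
  have hq0 : q.eval t ≠ 0 := fun h => hdvd (Polynomial.dvd_iff_isRoot.2 h)
  set p : Polynomial ℝ := Polynomial.C (q.eval t)⁻¹ * q with hp
  have hsymm : ∀ f : Polynomial ℝ, (Polynomial.aeval T f).IsSymmetric := by
    intro f
    induction f using Polynomial.induction_on' with
    | add f g hf hg => rw [map_add]; exact hf.add hg
    | monomial n a =>
      rw [Polynomial.aeval_monomial]
      intro v w
      simp only [Module.End.mul_apply, Module.algebraMap_end_apply, inner_smul_left,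
        inner_smul_right, RCLike.conj_to_real]
      rw [hT.pow n v w]
  refine ⟨p, fun v => ?_⟩
  refine Submodule.eq_starProjection_of_mem_of_inner_eq_zero ?_ ?_
  -- The extra 1 keeps the exponent positive even when `t` is not an eigenvalue.
  · rw [← hT.isFinitelySemisimple.genEigenspace_eq_eigenspace t
      (k := ((minpoly ℝ T).rootMultiplicity t + 1 : ℕ)) (by simp), Module.End.mem_genEigenspace_nat]
    rw [LinearMap.mem_ker]
    have h1 : (T - t • (1 : Module.End ℝ E)) =
        Polynomial.aeval T (Polynomial.X - Polynomial.C t) := by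
      ext; simp
    rw [h1, ← map_pow, ← Module.End.mul_apply, ← map_mul]
    have h2 : (Polynomial.X - Polynomial.C t) ^ ((minpoly ℝ T).rootMultiplicity t + 1) * p =
        ((Polynomial.X - Polynomial.C t) * Polynomial.C (q.eval t)⁻¹) * minpoly ℝ T := by
      conv_rhs => rw [hq]
      rw [hp]
      ring
    rw [h2, map_mul, minpoly.aeval, mul_zero, LinearMap.zero_apply]
  · intro w hw
    rw [inner_sub_left, hsymm p v w]
    have : Polynomial.aeval T p w = w := by
      by_cases hw0 : w = 0
      · simp [hw0]
      · rw [Module.End.aeval_apply_of_hasEigenvector ⟨hw, hw0⟩, hp]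
        simp [hq0]
    rw [this, sub_self]

/-- The diagonal entries of an orthogonal projection add up to its rank. -/
theorem sum_starProjection_single {ι : Type*} [Fintype ι] [DecidableEq ι]
    (S : Submodule ℝ (EuclideanSpace ℝ ι)) :
    ∑ y, S.starProjection (EuclideanSpace.single y 1) y = Module.finrank ℝ S := by
  have h : LinearMap.IsProj S (S.starProjection : EuclideanSpace ℝ ι →ₗ[ℝ] EuclideanSpace ℝ ι) :=
    ⟨fun x => S.starProjection_apply_mem x, fun x hx => S.starProjection_eq_self_iff.2 hx⟩
  rw [← h.trace, LinearMap.trace_eq_sum_inner _ (EuclideanSpace.basisFun ι ℝ)]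
  refine Finset.sum_congr rfl fun y _ => ?_
  rw [EuclideanSpace.basisFun_apply, EuclideanSpace.inner_single_left]
  simp

/-- The diagonal entries of an orthogonal projection are nonnegative. -/
theorem starProjection_single_self_nonneg {ι : Type*} [Fintype ι] [DecidableEq ι]
    (S : Submodule ℝ (EuclideanSpace ℝ ι)) (y : ι) :
    0 ≤ S.starProjection (EuclideanSpace.single y 1) y := by
  have h := S.re_inner_starProjection_nonneg (𝕜 := ℝ) (EuclideanSpace.single y (1 : ℝ))
  rw [EuclideanSpace.inner_single_right] at h
  simpa using h

/-- If all vectors of `K ≤ S` vanish at `y`, then the diagonal entry at `y` of the projection onto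
`S` is that of the projection onto the orthogonal complement of `K` in `S`. -/
theorem starProjection_single_eq_inf_orthogonal {ι : Type*} [Fintype ι] [DecidableEq ι]
    (S K : Submodule ℝ (EuclideanSpace ℝ ι)) (hK : K ≤ S) {y : ι} (hy : ∀ u ∈ K, u y = 0) :
    S.starProjection (EuclideanSpace.single y 1) =
      (S ⊓ Kᗮ).starProjection (EuclideanSpace.single y 1) := by
  refine (Submodule.eq_starProjection_of_mem_of_inner_eq_zero (Submodule.mem_inf.2 ⟨?_, ?_⟩)
    ?_).symm
  · exact S.starProjection_apply_mem _
  · rw [Submodule.mem_orthogonal]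
    intro u hu
    rw [← Submodule.inner_starProjection_left_eq_right, S.starProjection_eq_self_iff.2 (hK hu),
      EuclideanSpace.inner_single_right]
    simp [hy u hu]
  · intro w hw
    exact Submodule.starProjection_inner_eq_zero (K := S) _ w hw.1

end Projections

/-! ### Matrices whose entries depend only on the distance -/

section DistanceRegular

variable {V : Type*} [Fintype V] [DecidableEq V] {G : SimpleGraph V} [DecidableRel G.Adj]
  {bs cs : ℕ → ℕ}

theorem HasIntersectionNumbers.isRegularOfDegree (h : HasIntersectionNumbers G bs cs) :
    G.IsRegularOfDegree (bs 0) := by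
  intro x
  have h1 := h.card_succ x x
  rw [SimpleGraph.dist_self] at h1
  rw [← h1, ← SimpleGraph.card_neighborFinset_eq_degree, Finset.filter_true_of_mem]
  intro z hz
  rw [SimpleGraph.mem_neighborFinset] at hz
  rw [zero_add, SimpleGraph.dist_eq_one_iff_adj]
  exact hz

/-- The sum of a function of the distance to `x` over the neighbours of `y` which are not as far
from `x` as `y` is. -/
theorem HasIntersectionNumbers.sum_filter_dist_ne (h : HasIntersectionNumbers G bs cs)
    (f : ℕ → ℝ) (x y : V) :
    ∑ z ∈ (G.neighborFinset y).filter (fun z => G.dist x z ≠ G.dist x y), f (G.dist x z) =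
      cs (G.dist x y) * f (G.dist x y - 1) + bs (G.dist x y) * f (G.dist x y + 1) := by
  have hsplit : (G.neighborFinset y).filter (fun z => G.dist x z ≠ G.dist x y) =
      ((G.neighborFinset y).filter fun z => G.dist x z + 1 = G.dist x y) ∪
      ((G.neighborFinset y).filter fun z => G.dist x z = G.dist x y + 1) := by
    rw [← Finset.filter_or]
    refine Finset.filter_congr fun z hz => ?_
    rw [SimpleGraph.mem_neighborFinset] at hz
    have := hz.diff_dist_adj (u := x)
    omega
  rw [hsplit, Finset.sum_union, ← h.card_pred, ← h.card_succ]
  · congr 1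
    · rw [← nsmul_eq_mul, ← Finset.sum_const]
      refine Finset.sum_congr rfl fun z hz => ?_
      rw [← (Finset.mem_filter.1 hz).2, Nat.add_sub_cancel]
    · rw [← nsmul_eq_mul, ← Finset.sum_const]
      refine Finset.sum_congr rfl fun z hz => ?_
      rw [(Finset.mem_filter.1 hz).2]
  · rw [Finset.disjoint_left]
    intro z hz hz'
    have h1 := (Finset.mem_filter.1 hz).2
    have h2 := (Finset.mem_filter.1 hz').2
    omega

theorem HasIntersectionNumbers.card_filter_dist_eq (h : HasIntersectionNumbers G bs cs)
    (x y : V) :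
    (((G.neighborFinset y).filter fun z => G.dist x z = G.dist x y).card : ℝ) =
      bs 0 - bs (G.dist x y) - cs (G.dist x y) := by
  have h1 := h.sum_filter_dist_ne (fun _ => 1) x y
  have h2 := Finset.card_filter_add_card_filter_not (s := G.neighborFinset y)
    fun z => G.dist x z = G.dist x y
  rw [SimpleGraph.card_neighborFinset_eq_degree, h.isRegularOfDegree y] at h2
  rw [← h2]
  simp only [Finset.sum_const, nsmul_eq_mul, mul_one] at h1
  push_cast
  linarith

/-- The sum of a function of the distance to `x` over all neighbours of `y`. -/
theorem HasIntersectionNumbers.sum_dist (h : HasIntersectionNumbers G bs cs)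
    (f : ℕ → ℝ) (x y : V) :
    ∑ z ∈ G.neighborFinset y, f (G.dist x z) =
      cs (G.dist x y) * f (G.dist x y - 1) + bs (G.dist x y) * f (G.dist x y + 1) +
      (bs 0 - bs (G.dist x y) - cs (G.dist x y)) * f (G.dist x y) := by
  rw [← Finset.sum_filter_add_sum_filter_not _ (fun z => G.dist x z ≠ G.dist x y),
    h.sum_filter_dist_ne, ← h.card_filter_dist_eq]
  congr 1
  simp only [not_not]
  rw [← nsmul_eq_mul, ← Finset.sum_const]
  exact Finset.sum_congr rfl fun z hz => by rw [(Finset.mem_filter.1 hz).2]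

/-- The entries of a polynomial in the adjacency matrix of a distance-regular graph depend only on
the distance. -/
theorem HasIntersectionNumbers.exists_aeval_adjMatrix (h : HasIntersectionNumbers G bs cs)
    (p : Polynomial ℝ) :
    ∃ φ : ℕ → ℝ, ∀ x y, Polynomial.aeval (G.adjMatrix ℝ) p x y = φ (G.dist x y) := by
  have hpow : ∀ n : ℕ, ∃ φ : ℕ → ℝ, ∀ x y, (G.adjMatrix ℝ ^ n) x y = φ (G.dist x y) := by
    intro n
    induction n with
    | zero =>
      refine ⟨fun i => if i = 0 then 1 else 0, fun x y => ?_⟩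
      simp [Matrix.one_apply, h.connected.dist_eq_zero_iff]
    | succ n ih =>
      obtain ⟨φ, hφ⟩ := ih
      refine ⟨fun i => cs i * φ (i - 1) + bs i * φ (i + 1) + (bs 0 - bs i - cs i) * φ i,
        fun x y => ?_⟩
      rw [pow_succ, SimpleGraph.mul_adjMatrix_apply]
      exact (Finset.sum_congr rfl fun z _ => hφ x z).trans (h.sum_dist φ x y)
  induction p using Polynomial.induction_on' with
  | add f g hf hg =>
    obtain ⟨φ, hφ⟩ := hf
    obtain ⟨ψ, hψ⟩ := hg
    exact ⟨φ + ψ, fun x y => by simp [hφ, hψ]⟩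
  | monomial n a =>
    obtain ⟨φ, hφ⟩ := hpow n
    refine ⟨fun i => a * φ i, fun x y => ?_⟩
    rw [Polynomial.aeval_monomial, ← Algebra.smul_def, Matrix.smul_apply, hφ, smul_eq_mul]

/-- The eigenspace of the adjacency matrix of `G`, inside Euclidean space. -/
noncomputable def adjEigenspace (G : SimpleGraph V) [DecidableRel G.Adj] (t : ℝ) :
    Submodule ℝ (EuclideanSpace ℝ V) :=
  Module.End.eigenspace (Matrix.toEuclideanLin (G.adjMatrix ℝ)) t

theorem mem_adjEigenspace {t : ℝ} {u : EuclideanSpace ℝ V} :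
    u ∈ adjEigenspace G t ↔ ∀ x, ∑ z ∈ G.neighborFinset x, u z = t * u x := by
  rw [adjEigenspace, Module.End.mem_eigenspace_iff, PiLp.ext_iff]
  refine forall_congr' fun x => ?_
  rw [Matrix.toLpLin_apply]
  simp [SimpleGraph.adjMatrix_mulVec_apply]

/-- The projection is a polynomial in the adjacency matrix, so it inherits the dependence on
distance alone; in particular its diagonal is constant. -/
theorem HasIntersectionNumbers.exists_starProjection (h : HasIntersectionNumbers G bs cs)
    (t : ℝ) :
    ∃ φ : ℕ → ℝ, ∀ x y,
      (adjEigenspace G t).starProjection (EuclideanSpace.single y 1) x = φ (G.dist x y) := by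
  have hT : (Matrix.toEuclideanLin (G.adjMatrix ℝ)).IsSymmetric := by
    rw [Matrix.isSymmetric_toEuclideanLin_iff]
    rw [Matrix.IsHermitian, Matrix.conjTranspose_eq_transpose_of_trivial]
    exact G.isSymm_adjMatrix
  obtain ⟨p, hp⟩ := exists_aeval_eq_starProjection_eigenspace hT t
  obtain ⟨φ, hφ⟩ := h.exists_aeval_adjMatrix p
  refine ⟨φ, fun x y => ?_⟩
  rw [← hφ, adjEigenspace, hp]
  have h1 : Polynomial.aeval (Matrix.toEuclideanLin (G.adjMatrix ℝ)) p =
      Matrix.toEuclideanLin (Polynomial.aeval (G.adjMatrix ℝ) p) :=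
    Polynomial.aeval_algHom_apply (Matrix.toLpLinAlgEquiv (R := ℝ) (n := V) 2).toAlgHom
      (G.adjMatrix ℝ) p
  rw [h1, Matrix.toLpLin_apply]
  simp

end DistanceRegular

/-! ### The smallest eigenvalue and projections of cliques -/

section Eigenvalues

variable {V : Type*} [Fintype V] [DecidableEq V] {G : SimpleGraph V} [DecidableRel G.Adj]
  {bs cs : ℕ → ℕ}

theorem HasIntersectionNumbers.cs_zero (h : HasIntersectionNumbers G bs cs) : cs 0 = 0 := by
  obtain ⟨x⟩ := h.connected.nonempty
  have h1 := h.card_pred x x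
  rw [SimpleGraph.dist_self] at h1
  rw [← h1, Finset.card_eq_zero, Finset.filter_eq_empty_iff]
  exact fun z _ => Nat.succ_ne_zero _

/-- The entries of the projection onto an eigenspace satisfy the three-term recurrence. -/
theorem HasIntersectionNumbers.starProjection_recurrence (h : HasIntersectionNumbers G bs cs)
    {t : ℝ} {φ : ℕ → ℝ} (hφ : ∀ x y,
      (adjEigenspace G t).starProjection (EuclideanSpace.single y 1) x = φ (G.dist x y)) (x y : V) :
    cs (G.dist x y) * φ (G.dist x y - 1) + bs (G.dist x y) * φ (G.dist x y + 1) +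
      (bs 0 - bs (G.dist x y) - cs (G.dist x y)) * φ (G.dist x y) = t * φ (G.dist x y) := by
  have h1 := mem_adjEigenspace.1
    ((adjEigenspace G t).starProjection_apply_mem (EuclideanSpace.single x 1)) y
  simp only [hφ] at h1
  rw [G.dist_comm (u := y) (v := x)] at h1
  rw [← h1, ← h.sum_dist]
  exact Finset.sum_congr rfl fun z _ => by rw [G.dist_comm]

/-- The rank of the projection onto an eigenspace is read off from its diagonal entries. -/
theorem card_mul_starProjection_diag {t : ℝ} {φ : ℕ → ℝ} (hφ : ∀ x y,
      (adjEigenspace G t).starProjection (EuclideanSpace.single y 1) x = φ (G.dist x y)) :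
    Fintype.card V * φ 0 = Module.finrank ℝ (adjEigenspace G t) := by
  rw [← sum_starProjection_single]
  simp [hφ]

theorem starProjection_diag_pos {t : ℝ} {φ : ℕ → ℝ} (hφ : ∀ x y,
      (adjEigenspace G t).starProjection (EuclideanSpace.single y 1) x = φ (G.dist x y))
    (hne : adjEigenspace G t ≠ ⊥) : 0 < φ 0 := by
  have h1 := card_mul_starProjection_diag hφ
  have h2 : 0 < Module.finrank ℝ (adjEigenspace G t) :=
    Nat.pos_of_ne_zero fun h => hne (Submodule.finrank_eq_zero.1 h)
  have h3 : (0 : ℝ) < Fintype.card V * φ 0 := by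
    rw [h1]
    exact_mod_cast h2
  exact pos_of_mul_pos_right h3 (Nat.cast_nonneg _)

/-- A positive function `v` of the distance such that `(-1) ^ i * v i` is an eigenvector with
eigenvalue `-r` shows that every eigenvalue is at least `-r`. -/
theorem HasIntersectionNumbers.neg_le_eigenvalue (h : HasIntersectionNumbers G bs cs) {r : ℝ}
    {v : ℕ → ℝ} (hr : 0 ≤ r) (hv : ∀ x y, 0 < v (G.dist x y))
    (hrec : ∀ x y, cs (G.dist x y) * v (G.dist x y - 1) + bs (G.dist x y) * v (G.dist x y + 1) =
      (bs 0 - bs (G.dist x y) - cs (G.dist x y) + r) * v (G.dist x y))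
    {t : ℝ} (hne : adjEigenspace G t ≠ ⊥) : -r ≤ t := by
  by_contra! ht
  obtain ⟨φ, hφ⟩ := h.exists_starProjection t
  have hφ0 := starProjection_diag_pos hφ hne
  obtain ⟨x⟩ := h.connected.nonempty
  -- Triangle inequality in the three-term recurrence, whose diagonal coefficient is positive
  -- because `t < -r ≤ 0`.
  have hle : ∀ y, (bs 0 - bs (G.dist x y) - cs (G.dist x y) - t) * |φ (G.dist x y)| ≤
      ∑ z ∈ (G.neighborFinset y).filter (fun z => G.dist x z ≠ G.dist x y), |φ (G.dist x z)| := by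
    intro y
    have ha : (0 : ℝ) ≤ bs 0 - bs (G.dist x y) - cs (G.dist x y) := by
      rw [← h.card_filter_dist_eq]
      exact Nat.cast_nonneg _
    rw [← abs_of_pos (show 0 < bs 0 - bs (G.dist x y) - cs (G.dist x y) - t by linarith),
      ← abs_mul]
    refine le_trans (le_of_eq ?_) (Finset.abs_sum_le_sum_abs _ _)
    rw [← abs_neg]
    congr 1
    rw [h.sum_filter_dist_ne φ x y]
    linarith [h.starProjection_recurrence hφ x y]
  have hsum : ∑ y, v (G.dist x y) *
      ((bs 0 - bs (G.dist x y) - cs (G.dist x y) - t) * |φ (G.dist x y)|) ≤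
      ∑ y, ((bs 0 - bs (G.dist x y) - cs (G.dist x y) + r) * v (G.dist x y)) *
        |φ (G.dist x y)| := by
    calc _ ≤ ∑ y, v (G.dist x y) *
          ∑ z ∈ (G.neighborFinset y).filter (fun z => G.dist x z ≠ G.dist x y),
            |φ (G.dist x z)| :=
          Finset.sum_le_sum fun y _ => mul_le_mul_of_nonneg_left (hle y) (hv x y).le
      -- Adjacency restricted to pairs at different distances from `x` is symmetric, so it can be
      -- moved from `|φ|` onto `v`.
      _ = ∑ z, (∑ y ∈ (G.neighborFinset z).filter (fun y => G.dist x y ≠ G.dist x z),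
            v (G.dist x y)) * |φ (G.dist x z)| := by
          simp_rw [Finset.mul_sum, Finset.sum_mul]
          refine Finset.sum_comm' fun y z => ?_
          simp only [Finset.mem_univ, true_and, and_true, Finset.mem_filter,
            SimpleGraph.mem_neighborFinset]
          rw [G.adj_comm, ne_comm]
      _ = _ := Finset.sum_congr rfl fun z _ => by rw [h.sum_filter_dist_ne, hrec]
  have hlt : ∑ y, ((bs 0 - bs (G.dist x y) - cs (G.dist x y) + r) * v (G.dist x y)) *
        |φ (G.dist x y)| < ∑ y, v (G.dist x y) *
      ((bs 0 - bs (G.dist x y) - cs (G.dist x y) - t) * |φ (G.dist x y)|) := by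
    have hterm : ∀ y, v (G.dist x y) *
        ((bs 0 - bs (G.dist x y) - cs (G.dist x y) - t) * |φ (G.dist x y)|) -
        ((bs 0 - bs (G.dist x y) - cs (G.dist x y) + r) * v (G.dist x y)) * |φ (G.dist x y)| =
        (-r - t) * (v (G.dist x y) * |φ (G.dist x y)|) := fun y => by ring
    have hpos : 0 < -r - t := by linarith
    refine Finset.sum_lt_sum (fun y _ => ?_) ⟨x, Finset.mem_univ x, ?_⟩
    · have := hterm y
      have := mul_nonneg hpos.le (mul_nonneg (hv x y).le (abs_nonneg (φ (G.dist x y))))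
      linarith
    · have := hterm x
      have := mul_pos hpos (mul_pos (hv x x)
        (abs_pos.2 (show φ (G.dist x x) ≠ 0 by rw [SimpleGraph.dist_self]; exact hφ0.ne')))
      linarith
  exact absurd hsum (not_le.2 hlt)

theorem HasIntersectionNumbers.adjEigenspace_neg_ne_bot (h : HasIntersectionNumbers G bs cs)
    {r : ℝ} {v : ℕ → ℝ} (hv : v 0 ≠ 0)
    (hrec : ∀ x y, cs (G.dist x y) * v (G.dist x y - 1) + bs (G.dist x y) * v (G.dist x y + 1) =
      (bs 0 - bs (G.dist x y) - cs (G.dist x y) + r) * v (G.dist x y)) :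
    adjEigenspace G (-r) ≠ ⊥ := by
  obtain ⟨x⟩ := h.connected.nonempty
  rw [Submodule.ne_bot_iff]
  refine ⟨WithLp.toLp 2 fun y => (-1) ^ G.dist x y * v (G.dist x y), ?_, fun h0 => ?_⟩
  · rw [mem_adjEigenspace]
    intro y
    change ∑ z ∈ G.neighborFinset y, (-1 : ℝ) ^ G.dist x z * v (G.dist x z) =
      -r * ((-1) ^ G.dist x y * v (G.dist x y))
    rw [h.sum_dist (fun i => (-1 : ℝ) ^ i * v i) x y]
    have h1 := hrec x y
    -- At distance 0 the truncated index `0 - 1` is harmless, since `cs 0 = 0`.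
    rcases Nat.eq_zero_or_pos (G.dist x y) with h2 | h2
    · rw [h2, h.cs_zero] at h1 ⊢
      push_cast at h1 ⊢
      linear_combination -h1
    · obtain ⟨i, hi⟩ := Nat.exists_eq_succ_of_ne_zero h2.ne'
      rw [hi] at h1 ⊢
      simp only [Nat.succ_eq_add_one, Nat.add_sub_cancel] at h1 ⊢
      linear_combination (-1 : ℝ) ^ i * h1
  · have h1 := congrFun (congrArg WithLp.ofLp h0) x
    simp only [SimpleGraph.dist_self, pow_zero, one_mul] at h1
    exact hv h1

/-- If all eigenvalues are at least `-r`, then `A + r` is positive semidefinite. -/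
theorem neg_mul_sum_sq_le {r : ℝ} (hr : ∀ t, adjEigenspace G t ≠ ⊥ → -r ≤ t) (u : V → ℝ) :
    -r * ∑ x, u x ^ 2 ≤ ∑ x, u x * ∑ z ∈ G.neighborFinset x, u z := by
  have hA : (G.adjMatrix ℝ + r • (1 : Matrix V V ℝ)).IsHermitian := by
    rw [Matrix.IsHermitian, Matrix.conjTranspose_eq_transpose_of_trivial, Matrix.transpose_add,
      Matrix.transpose_smul, Matrix.transpose_one, G.transpose_adjMatrix]
  have hpsd : (G.adjMatrix ℝ + r • (1 : Matrix V V ℝ)).PosSemidef := by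
    rw [hA.posSemidef_iff_eigenvalues_nonneg]
    intro i
    have h1 := hA.mulVec_eigenvectorBasis i
    have h2 : hA.eigenvectorBasis i ∈ adjEigenspace G (hA.eigenvalues i - r) := by
      rw [mem_adjEigenspace]
      intro x
      have h3 := congrFun h1 x
      rw [Matrix.add_mulVec, Pi.add_apply, SimpleGraph.adjMatrix_mulVec_apply,
        Matrix.smul_mulVec, Matrix.one_mulVec] at h3
      simp only [Pi.smul_apply, smul_eq_mul] at h3
      linarith
    have h4 : adjEigenspace G (hA.eigenvalues i - r) ≠ ⊥ := by
      rw [Submodule.ne_bot_iff]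
      exact ⟨_, h2, hA.eigenvectorBasis.orthonormal.ne_zero i⟩
    have := hr _ h4
    change 0 ≤ hA.eigenvalues i
    linarith
  have h1 := hpsd.dotProduct_mulVec_nonneg u
  rw [Matrix.add_mulVec, Matrix.smul_mulVec, Matrix.one_mulVec, dotProduct_add,
    dotProduct_smul] at h1
  simp only [dotProduct, star_trivial, SimpleGraph.adjMatrix_mulVec_apply, smul_eq_mul] at h1
  simp only [← pow_two] at h1
  linarith

/-- The squared length of the projection of the characteristic vector of a clique onto an
eigenspace. -/
theorem norm_sq_starProjection_clique {t : ℝ} {φ : ℕ → ℝ} (hφ : ∀ x y,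
      (adjEigenspace G t).starProjection (EuclideanSpace.single y 1) x = φ (G.dist x y))
    {L : Finset V} (hL : G.IsClique (L : Set V)) :
    ‖(adjEigenspace G t).starProjection (∑ y ∈ L, EuclideanSpace.single y (1 : ℝ))‖ ^ 2 =
      L.card * (φ 0 + (L.card - 1) * φ 1) := by
  have hinner : ∀ x y : V, inner ℝ (EuclideanSpace.single x (1 : ℝ))
      ((adjEigenspace G t).starProjection (EuclideanSpace.single y 1)) = φ (G.dist x y) := by
    intro x y
    rw [EuclideanSpace.inner_single_left, hφ]
    simp
  have hrow : ∀ x ∈ L, ∑ y ∈ L, φ (G.dist x y) = φ 0 + (L.card - 1) * φ 1 := by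
    intro x hx
    rw [← Finset.add_sum_erase L _ hx, SimpleGraph.dist_self]
    congr 1
    have h1 : ((L.erase x).card : ℝ) = L.card - 1 := by
      rw [← Finset.card_erase_add_one hx]
      push_cast
      ring
    rw [← h1, ← nsmul_eq_mul, ← Finset.sum_const]
    refine Finset.sum_congr rfl fun y hy => ?_
    rw [SimpleGraph.dist_eq_one_iff_adj.2]
    exact hL hx (Finset.mem_of_mem_erase hy) (Finset.ne_of_mem_erase hy).symm
  rw [← real_inner_self_eq_norm_sq, Submodule.inner_starProjection_left_eq_right,
    Submodule.starProjection_eq_self_iff.2 (Submodule.starProjection_apply_mem _ _),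
    map_sum, sum_inner]
  simp_rw [inner_sum, hinner]
  rw [Finset.sum_congr rfl hrow, Finset.sum_const, nsmul_eq_mul]

end Eigenvalues

/-! ### Rank count for a system of lines -/

section LineSystems

variable {V : Type*} [Fintype V] [DecidableEq V] {G : SimpleGraph V} [DecidableRel G.Adj]
  {bs cs : ℕ → ℕ}

/-- If the members of `𝓢` are larger than `2 * a`, are contained in `B`, and each element of `B` is
in fewer than `a` of them, then there are fewer than `#B / 2` of them. -/
theorem two_mul_card_lt_of_incidence {𝓢 : Finset (Finset V)} {B : Finset V} {a : ℝ} (ha : 0 < a)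
    (hne : 𝓢.Nonempty) (hsub : ∀ L ∈ 𝓢, L ⊆ B) (hlarge : ∀ L ∈ 𝓢, 2 * a < L.card)
    (hfew : ∀ y ∈ B, ((𝓢.filter fun L => y ∈ L).card : ℝ) < a) : 2 * (𝓢.card : ℝ) < B.card := by
  have hswap : ∑ y ∈ B, (𝓢.filter fun L => y ∈ L).card = ∑ L ∈ 𝓢, L.card := by
    refine (Finset.sum_card_bipartiteAbove_eq_sum_card_bipartiteBelow (s := B) (t := 𝓢)
      fun y L => y ∈ L).trans (Finset.sum_congr rfl fun L hL => ?_)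
    rw [Finset.bipartiteBelow, Finset.filter_mem_eq_inter, Finset.inter_eq_right.2 (hsub L hL)]
  have h1 : (𝓢.card : ℝ) * (2 * a) < ∑ L ∈ 𝓢, (L.card : ℝ) := by
    rw [← nsmul_eq_mul, ← Finset.sum_const]
    exact Finset.sum_lt_sum_of_nonempty hne hlarge
  have h2 : ∑ y ∈ B, ((𝓢.filter fun L => y ∈ L).card : ℝ) ≤ B.card * a := by
    rw [← nsmul_eq_mul, ← Finset.sum_const]
    exact Finset.sum_le_sum fun y hy => (hfew y hy).le
  have h3 : ∑ y ∈ B, ((𝓢.filter fun L => y ∈ L).card : ℝ) = ∑ L ∈ 𝓢, (L.card : ℝ) := by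
    exact_mod_cast hswap
  rw [h3] at h2
  nlinarith

/-- The linear map sending a vector to its sums over the members of `𝓢`. -/
noncomputable def lineSums (𝓢 : Finset (Finset V)) : EuclideanSpace ℝ V →ₗ[ℝ] (𝓢 → ℝ) where
  toFun u L := ∑ x ∈ L.1, u x
  map_add' u v := by
    ext L
    simp [Finset.sum_add_distrib]
  map_smul' a u := by
    ext L
    simp [Finset.mul_sum]

theorem mem_ker_lineSums {𝓢 : Finset (Finset V)} {u : EuclideanSpace ℝ V} :
    u ∈ LinearMap.ker (lineSums 𝓢) ↔ ∀ L ∈ 𝓢, ∑ x ∈ L, u x = 0 := by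
  rw [LinearMap.mem_ker, funext_iff]
  exact ⟨fun h L hL => h ⟨L, hL⟩, fun h L => h L.1 L.2⟩

theorem card_le_finrank_ker_lineSums_add (𝓢 : Finset (Finset V)) :
    Fintype.card V ≤ Module.finrank ℝ (LinearMap.ker (lineSums 𝓢)) + 𝓢.card := by
  have h1 := (lineSums 𝓢).finrank_range_add_finrank_ker
  have h2 := (LinearMap.range (lineSums 𝓢)).finrank_le
  rw [Module.finrank_fintype_fun_eq_card, Fintype.card_coe] at h2
  rw [finrank_euclideanSpace] at h1
  omega

/-- A vector of this space with all line sums zero also lies in the subspace it is orthogonal to, so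
`lineSums 𝓢` is injective here. -/
theorem finrank_inf_orthogonal_le_card (E : Submodule ℝ (EuclideanSpace ℝ V))
    (𝓢 : Finset (Finset V)) :
    Module.finrank ℝ ↥(E ⊓ (E ⊓ LinearMap.ker (lineSums 𝓢))ᗮ) ≤ 𝓢.card := by
  set F := E ⊓ (E ⊓ LinearMap.ker (lineSums 𝓢))ᗮ with hF
  have hinj : Function.Injective ((lineSums 𝓢).domRestrict F) := by
    rw [← LinearMap.ker_eq_bot, LinearMap.ker_eq_bot']
    intro u hu
    have h1 : (u : EuclideanSpace ℝ V) ∈ E ⊓ LinearMap.ker (lineSums 𝓢) :=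
      ⟨(Submodule.mem_inf.1 u.2).1, hu⟩
    have h2 := (Submodule.mem_orthogonal _ _).1 (Submodule.mem_inf.1 u.2).2 _ h1
    exact Subtype.ext (inner_self_eq_zero.1 h2)
  have h := LinearMap.finrank_le_finrank_of_injective hinj
  rwa [Module.finrank_fintype_fun_eq_card, Fintype.card_coe] at h

/-- A sum over the neighbours of `x`, computed along the cliques through `x` of a family of cliques
that contains every edge exactly once. -/
theorem sum_neighborFinset_eq_sum_lines {𝓛 : Finset (Finset V)}
    (hcl : ∀ L ∈ 𝓛, G.IsClique (L : Set V))
    (huniq : ∀ x y, G.Adj x y → ∃! L, L ∈ 𝓛 ∧ x ∈ L ∧ y ∈ L) (f : V → ℝ) (x : V) :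
    ∑ z ∈ G.neighborFinset x, f z = ∑ L ∈ 𝓛.filter (fun L => x ∈ L), (∑ z ∈ L, f z - f x) := by
  have hN : G.neighborFinset x = (𝓛.filter fun L => x ∈ L).biUnion fun L => L.erase x := by
    ext z
    simp only [SimpleGraph.mem_neighborFinset, Finset.mem_biUnion, Finset.mem_filter,
      Finset.mem_erase]
    constructor
    · intro hz
      obtain ⟨L, ⟨hL, hx, hzL⟩, _⟩ := huniq x z hz
      exact ⟨L, ⟨hL, hx⟩, hz.ne', hzL⟩
    · rintro ⟨L, ⟨hL, hx⟩, hne, hz⟩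
      exact hcl L hL hx hz hne.symm
  rw [hN, Finset.sum_biUnion]
  · refine Finset.sum_congr rfl fun L hL => ?_
    rw [Finset.sum_erase_eq_sub (Finset.mem_filter.1 hL).2]
  · intro L hL L' hL' hne
    rw [Function.onFun, Finset.disjoint_left]
    intro z hz hz'
    rw [Finset.mem_coe, Finset.mem_filter] at hL hL'
    rw [Finset.mem_erase] at hz hz'
    have hadj : G.Adj x z := hcl L hL.1 hL.2 hz.2 hz.1.symm
    exact hne ((huniq x z hadj).unique ⟨hL.1, hL.2, hz.2⟩ ⟨hL'.1, hL'.2, hz'.2⟩)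

/-- Let `G` be distance-regular of valency `r * β` with smallest eigenvalue `-r`. If a family of
cliques with more than `(β + 1) / 2` vertices contains every edge exactly once, and `β` is large
compared with `r`, then all these cliques have exactly `1 + β` vertices. -/
theorem HasIntersectionNumbers.card_line_eq (h : HasIntersectionNumbers G bs cs) {r β : ℝ}
    (hr : 0 < r) (hβ : 1 < β) (hk : (bs 0 : ℝ) = r * β) (hbig : 8 * (r * β) < β ^ 2 - 1)
    (hmin : ∀ t, adjEigenspace G t ≠ ⊥ → -r ≤ t) (hne : adjEigenspace G (-r) ≠ ⊥)
    {𝓛 : Finset (Finset V)} (hcl : ∀ L ∈ 𝓛, G.IsClique (L : Set V))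
    (hcard : ∀ L ∈ 𝓛, (β + 1) / 2 < L.card)
    (huniq : ∀ x y, G.Adj x y → ∃! L, L ∈ 𝓛 ∧ x ∈ L ∧ y ∈ L) :
    ∀ L ∈ 𝓛, (L.card : ℝ) = 1 + β := by
  obtain ⟨φ, hφ⟩ := h.exists_starProjection (-r)
  have hφ0 := starProjection_diag_pos hφ hne
  set E := adjEigenspace G (-r) with hE
  -- This is the recurrence at distance 0, divided by `r`.
  have hφ1 : β * φ 1 = -φ 0 := by
    obtain ⟨x⟩ := h.connected.nonempty
    have h1 := h.starProjection_recurrence hφ x x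
    rw [SimpleGraph.dist_self, h.cs_zero, hk] at h1
    push_cast at h1
    have h2 : r * (β * φ 1 + φ 0) = 0 := by linear_combination h1
    have := (mul_eq_zero.1 h2).resolve_left hr.ne'
    linarith
  have hnorm : ∀ L ∈ 𝓛,
      β * ‖E.starProjection (∑ y ∈ L, EuclideanSpace.single y (1 : ℝ))‖ ^ 2 =
      L.card * φ 0 * (1 + β - L.card) := by
    intro L hL
    rw [norm_sq_starProjection_clique hφ (hcl L hL)]
    linear_combination (L.card : ℝ) * (L.card - 1) * hφ1
  have hpos : ∀ L ∈ 𝓛, (0 : ℝ) < L.card := fun L hL => by linarith [hcard L hL]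
  have hdelsarte : ∀ L ∈ 𝓛, (L.card : ℝ) ≤ 1 + β := by
    intro L hL
    have h1 : 0 ≤ L.card * φ 0 * (1 + β - L.card) := by
      rw [← hnorm L hL]
      positivity
    have := nonneg_of_mul_nonneg_right h1 (mul_pos (hpos L hL) hφ0)
    linarith
  have hfull : ∀ L ∈ 𝓛, (L.card : ℝ) = 1 + β → ∀ u ∈ E, ∑ x ∈ L, u x = 0 := by
    intro L hL hLc u hu
    have h1 := hnorm L hL
    rw [hLc, sub_self, mul_zero] at h1
    have h2 : E.starProjection (∑ y ∈ L, EuclideanSpace.single y (1 : ℝ)) = 0 := by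
      have := (mul_eq_zero.1 h1).resolve_left (by linarith)
      exact norm_eq_zero.1 (pow_eq_zero_iff two_ne_zero |>.1 this)
    have h3 : inner ℝ u (∑ y ∈ L, EuclideanSpace.single y (1 : ℝ)) = 0 := by
      rw [← E.starProjection_eq_self_iff.2 hu, Submodule.inner_starProjection_left_eq_right, h2,
        inner_zero_right]
    rw [inner_sum] at h3
    simpa [EuclideanSpace.inner_single_right] using h3
  set m : V → ℕ := fun x => (𝓛.filter fun L => x ∈ L).card with hm
  have hdeg : ∀ x, ∑ L ∈ 𝓛.filter (fun L => x ∈ L), ((L.card : ℝ) - 1) = r * β := by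
    intro x
    have h1 := sum_neighborFinset_eq_sum_lines hcl huniq (fun _ => 1) x
    simp only [Finset.sum_const, nsmul_eq_mul, mul_one] at h1
    rw [SimpleGraph.card_neighborFinset_eq_degree, h.isRegularOfDegree x, hk] at h1
    exact h1.symm
  -- Each line through `x` uses more than `(β - 1) / 2` of its `r * β` neighbours; `hbig` does the
  -- rest.
  have hm_lt : ∀ x, (m x : ℝ) < (β + 1) / 4 := by
    intro x
    have h1 : (m x : ℝ) * ((β - 1) / 2) ≤ r * β := by
      rw [← hdeg x, ← nsmul_eq_mul, ← Finset.sum_const]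
      refine Finset.sum_le_sum fun L hL => ?_
      linarith [hcard L (Finset.mem_filter.1 hL).1]
    by_contra! hcon
    nlinarith
  have hm_ge : ∀ x, r ≤ m x := by
    intro x
    have h1 : r * β ≤ m x * β := by
      rw [← hdeg x, ← nsmul_eq_mul, ← Finset.sum_const]
      refine Finset.sum_le_sum fun L hL => ?_
      linarith [hdelsarte L (Finset.mem_filter.1 hL).1]
    exact le_of_mul_le_mul_right h1 (by linarith)
  by_contra! hcon
  set 𝓝 : Finset (Finset V) := 𝓛.filter fun L => (L.card : ℝ) ≠ 1 + β with h𝓝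
  have h𝓝ne : 𝓝.Nonempty := by
    obtain ⟨L, hL, hLc⟩ := hcon
    exact ⟨L, Finset.mem_filter.2 ⟨hL, hLc⟩⟩
  have h𝓝sub : 𝓝 ⊆ 𝓛 := Finset.filter_subset _ _
  set B : Finset V := 𝓝.biUnion id with hB
  have hm_gt : ∀ x ∈ B, r < m x := by
    intro x hx
    obtain ⟨L, hL, hxL⟩ := Finset.mem_biUnion.1 hx
    obtain ⟨hL, hLc⟩ := Finset.mem_filter.1 hL
    have h1 : r * β < m x * β := by
      rw [← hdeg x, ← nsmul_eq_mul, ← Finset.sum_const]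
      refine Finset.sum_lt_sum (fun L hL => ?_) ⟨L, Finset.mem_filter.2 ⟨hL, hxL⟩, ?_⟩
      · linarith [hdelsarte L (Finset.mem_filter.1 hL).1]
      · linarith [lt_of_le_of_ne (hdelsarte L hL) hLc]
    exact lt_of_mul_lt_mul_right h1 (by linarith)
  have hker : ∀ u ∈ LinearMap.ker (lineSums 𝓛), ∀ x, (m x - r) * u x = 0 ∧
      ∑ z ∈ G.neighborFinset x, u z = -(m x) * u x := by
    intro u hu
    rw [mem_ker_lineSums] at hu
    have hnb : ∀ x, ∑ z ∈ G.neighborFinset x, u z = -(m x) * u x := by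
      intro x
      rw [sum_neighborFinset_eq_sum_lines hcl huniq (fun z => u z) x,
        Finset.sum_congr rfl fun L hL => by rw [hu L (Finset.mem_filter.1 hL).1],
        Finset.sum_const, nsmul_eq_mul]
      ring
    have hnonneg : ∀ x ∈ Finset.univ, 0 ≤ (m x - r) * u x ^ 2 := fun x _ =>
      mul_nonneg (by linarith [hm_ge x]) (sq_nonneg _)
    -- A vector with zero line sums is multiplied by `-m x` at each `x`, so semidefiniteness bounds
    -- a sum of nonnegative terms by 0.
    have hsum : ∑ x, (m x - r) * u x ^ 2 ≤ 0 := by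
      have h1 := neg_mul_sum_sq_le hmin (fun x => u x)
      simp only [hnb] at h1
      rw [Finset.mul_sum] at h1
      have h2 : ∑ x, (m x - r) * u x ^ 2 = ∑ x, -r * u x ^ 2 - ∑ x, u x * (-(m x) * u x) := by
        rw [← Finset.sum_sub_distrib]
        exact Finset.sum_congr rfl fun x _ => by ring
      linarith
    have hzero := (Finset.sum_eq_zero_iff_of_nonneg hnonneg).1
      (le_antisymm hsum (Finset.sum_nonneg hnonneg))
    intro x
    refine ⟨?_, hnb x⟩
    rcases mul_eq_zero.1 (hzero x (Finset.mem_univ x)) with h1 | h1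
    · rw [h1, zero_mul]
    · rw [pow_eq_zero_iff two_ne_zero |>.1 h1, mul_zero]
  have hkerE : LinearMap.ker (lineSums 𝓛) ≤ E := by
    intro u hu
    rw [hE, mem_adjEigenspace]
    intro x
    obtain ⟨h1, h2⟩ := hker u hu x
    linarith
  have hvanish : ∀ u ∈ E ⊓ LinearMap.ker (lineSums 𝓝), ∀ y ∈ B, u y = 0 := by
    intro u hu y hy
    have hu' : u ∈ LinearMap.ker (lineSums 𝓛) := by
      rw [mem_ker_lineSums]
      intro L hL
      by_cases hLc : (L.card : ℝ) = 1 + β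
      · exact hfull L hL hLc u hu.1
      · exact mem_ker_lineSums.1 hu.2 L (Finset.mem_filter.2 ⟨hL, hLc⟩)
    exact (mul_eq_zero.1 (hker u hu' y).1).resolve_left (by linarith [hm_gt y hy])
  have hB_le : (B.card : ℝ) * φ 0 ≤ 𝓝.card := by
    have h1 := sum_starProjection_single (E ⊓ (E ⊓ LinearMap.ker (lineSums 𝓝))ᗮ)
    have h2 : ((Module.finrank ℝ ↥(E ⊓ (E ⊓ LinearMap.ker (lineSums 𝓝))ᗮ) : ℕ) : ℝ) ≤ 𝓝.card :=
      Nat.cast_le.2 (finrank_inf_orthogonal_le_card E 𝓝)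
    refine le_trans ?_ (h1.trans_le h2)
    refine le_trans (le_of_eq ?_) (Finset.sum_le_sum_of_subset_of_nonneg (Finset.subset_univ B)
      fun y _ _ => starProjection_single_self_nonneg _ y)
    rw [← nsmul_eq_mul, ← Finset.sum_const]
    refine Finset.sum_congr rfl fun y hy => ?_
    rw [← starProjection_single_eq_inf_orthogonal E _ inf_le_left fun u hu => hvanish u hu y hy,
      hφ, SimpleGraph.dist_self]
  have hV : (Fintype.card V : ℝ) ≤ Fintype.card V * φ 0 + 𝓛.card := by
    rw [card_mul_starProjection_diag hφ]
    exact_mod_cast (card_le_finrank_ker_lineSums_add 𝓛).trans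
      (Nat.add_le_add_right (Submodule.finrank_mono hkerE) _)
  have ha : 0 < (β + 1) / 4 := by linarith
  have hlarge : ∀ L ∈ 𝓛, 2 * ((β + 1) / 4) < L.card := fun L hL => by linarith [hcard L hL]
  have h1 : 2 * (𝓛.card : ℝ) < (Finset.univ : Finset V).card :=
    two_mul_card_lt_of_incidence ha (h𝓝ne.mono h𝓝sub) (fun L _ => Finset.subset_univ L) hlarge
      fun y _ => hm_lt y
  have h2 : 2 * (𝓝.card : ℝ) < B.card := by
    refine two_mul_card_lt_of_incidence ha h𝓝ne
      (fun L hL => Finset.subset_biUnion_of_mem id hL) (fun L hL => hlarge L (h𝓝sub hL))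
      fun y _ => lt_of_le_of_lt ?_ (hm_lt y)
    exact Nat.cast_le.2 (Finset.card_le_card (Finset.filter_subset_filter _ h𝓝sub))
  rw [Finset.card_univ] at h1
  have hVpos : (0 : ℝ) < Fintype.card V := by
    have : (0 : ℝ) ≤ 𝓛.card := Nat.cast_nonneg _
    linarith
  have hBpos : (0 : ℝ) < B.card := by
    have : (0 : ℝ) ≤ 𝓝.card := Nat.cast_nonneg _
    linarith
  have h3 : 1 / 2 < φ 0 := by
    by_contra! hcon'
    nlinarith
  nlinarith

end LineSystems

/-! ### Numerical bounds on the classical parameters -/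

section Parameters

theorem gaussNumber_zero {b : ℝ} : gaussNumber b 0 = 0 := by
  simp [gaussNumber]

theorem gaussNumber_succ {b : ℝ} (hb : 2 ≤ b) (i : ℕ) :
    gaussNumber b (i + 1) = 1 + b * gaussNumber b i := by
  have h1 : b ≠ 1 := by linarith
  have h2 : b - 1 ≠ 0 := sub_ne_zero.2 h1
  rw [gaussNumber, gaussNumber, if_neg h1, if_neg h1]
  field_simp
  ring

theorem gaussNumber_nonneg {b : ℝ} (hb : 2 ≤ b) (i : ℕ) : 0 ≤ gaussNumber b i := by
  induction i with
  | zero => rw [gaussNumber_zero]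
  | succ i ih => rw [gaussNumber_succ hb]; nlinarith

theorem gaussNumber_strictMono {b : ℝ} (hb : 2 ≤ b) : StrictMono (gaussNumber b) := by
  refine strictMono_nat_of_lt_succ fun i => ?_
  have := gaussNumber_nonneg hb i
  rw [gaussNumber_succ hb]
  nlinarith

/-- The lower bounds on `β`, cleared of denominators and with `M = c₂ - 1`. -/
theorem classical_parameter_bounds_aux {b β r M : ℝ} (hb : 2 ≤ b) (hr : 7 ≤ r) (hM : 0 < M)
    (hβ1 : (2 * b + 4) / (2 * b + 3) * r * (b + 2) * M ≤ β)
    (hβ2 : (2 * b + 4) / (2 * b + 3) * r * ((b + 1) * (b ^ 2 + b + 2) - 3) ≤ β) :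
    21 * r ≤ β ∧ 70 * b ≤ β ∧ 32 * (r * M) ≤ 7 * β := by
  have h3 : 0 < 2 * b + 3 := by linarith
  have hr0 : 0 ≤ r := by linarith
  have hb2 : 2 * b ≤ b ^ 2 := by nlinarith only [hb]
  have hb3 : 2 * b ^ 2 ≤ b ^ 3 := by nlinarith only [hb, sq_nonneg b]
  -- The constants come from the extreme case b = 2, r = 7: the cubic is 21 there, 70 = 7 · 10, and
  -- (2b + 4)(b + 2) / (2b + 3) is 32/7.
  have hS : 21 ≤ (b + 1) * (b ^ 2 + b + 2) - 3 := by linarith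
  have hSb : 10 * b ≤ (b + 1) * (b ^ 2 + b + 2) - 3 := by linarith
  have hβ2' : r * ((b + 1) * (b ^ 2 + b + 2) - 3) ≤ β := by
    refine le_trans ?_ hβ2
    have h1 : 1 ≤ (2 * b + 4) / (2 * b + 3) := by
      rw [le_div_iff₀ h3]
      linarith
    rw [mul_assoc]
    exact le_mul_of_one_le_left (mul_nonneg hr0 (by linarith)) h1
  refine ⟨?_, ?_, ?_⟩
  · linarith [mul_le_mul_of_nonneg_left hS hr0]
  · linarith [mul_le_mul_of_nonneg_left hSb hr0,
      mul_le_mul_of_nonneg_right hr (show 0 ≤ b by linarith)]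
  · have hβ1' : (2 * b + 4) * (b + 2) * (r * M) ≤ (2 * b + 3) * β := by
      have h : (2 * b + 4) / (2 * b + 3) * r * (b + 2) * M =
          ((2 * b + 4) * (b + 2) * (r * M)) / (2 * b + 3) := by ring
      rw [h, div_le_iff₀ h3] at hβ1
      linarith
    have hrM0 : 0 ≤ r * M := mul_nonneg hr0 hM.le
    have h1 : 32 * (2 * b + 3) ≤ 7 * ((2 * b + 4) * (b + 2)) := by linarith
    have h2 := mul_le_mul_of_nonneg_right h1 hrM0
    refine le_of_mul_le_mul_left ?_ h3
    linarith

/-- The numerical consequences of the lower bound on `β`. -/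
theorem classical_parameter_bounds {b α β r p : ℝ} (hb : 2 ≤ b) (hr : r = 1 + b * p)
    (hp : b + 1 ≤ p) (hαp : 0 < 1 + α * p) (hα : 0 < 1 + α * (b + 1))
    (hβ1 : (2 * b + 4) / (2 * b + 3) * r * (b + 2) * (α * b + b + α) ≤ β)
    (hβ2 : (2 * b + 4) / (2 * b + 3) * r * ((b + 1) * (b ^ 2 + b + 2) - 3) ≤ β) :
    8 * (r * β) < β ^ 2 - 1 ∧ 0 < β + α * (r - 1) - (α * b + b + α) ∧
      4 * ((r - 1) * (β - α)) * (α * b + b + α) < (β + α * (r - 1) - (α * b + b + α)) ^ 2 := by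
  have hr7 : 7 ≤ r := by
    rw [hr]
    nlinarith only [hb, hp]
  have hM0 : 0 < α * b + b + α := by linarith
  have hαr : -b < α * (r - 1) := by
    rw [hr]
    nlinarith only [hb, hαp]
  have hα3 : -1 < 3 * α := by
    by_contra! hcon
    nlinarith only [hb, hα, hcon]
  obtain ⟨hβr, hβb, hrM⟩ := classical_parameter_bounds_aux hb hr7 hM0 hβ1 hβ2
  generalize α * b + b + α = M at *
  have hM28 : 28 * M ≤ β := by linarith [mul_le_mul_of_nonneg_right hr7 hM0.le]
  -- The losses are `b ≤ β / 70` and `M ≤ β / 28`, and 1/70 + 1/28 = 1/20.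
  have hQ : 19 / 20 * β ≤ β + α * (r - 1) - M := by linarith
  have hβ0 : 0 < β := by linarith
  have h4 : 4 * ((r - 1) * M) ≤ 7 / 8 * β := by linarith
  have h5 : β - α ≤ 101 / 100 * β := by linarith
  have h6 : 0 ≤ 4 * ((r - 1) * M) := by
    have := mul_nonneg (show 0 ≤ r - 1 by linarith) hM0.le
    linarith
  -- It suffices that 7/8 · 101/100 = 0.88375 is below (19/20)² = 0.9025.
  have h7 : 4 * ((r - 1) * M) * (β - α) ≤ 7 / 8 * β * (101 / 100 * β) :=
    (mul_le_mul_of_nonneg_left h5 h6).trans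
      (mul_le_mul_of_nonneg_right h4 (by linarith))
  have h8 : (19 / 20 * β) ^ 2 ≤ (β + α * (r - 1) - M) ^ 2 :=
    pow_le_pow_left₀ (by linarith) hQ 2
  have h9 : 0 < β ^ 2 := by positivity
  refine ⟨?_, by linarith, by linarith⟩
  nlinarith only [hβr, hr7]

/-! ### Distances, intersection numbers and common neighbours -/

variable {V : Type*} [Fintype V] [DecidableEq V] {G : SimpleGraph V} [DecidableRel G.Adj]
  {bs cs : ℕ → ℕ}

theorem SimpleGraph.Connected.exists_adj_dist_eq {V : Type*} {G : SimpleGraph V}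
    (hG : G.Connected) {x y : V} {i : ℕ} (hxy : G.dist x y = i + 1) :
    ∃ z, G.Adj y z ∧ G.dist x z = i := by
  obtain ⟨p, hp⟩ := hG.exists_walk_length_eq_dist y x
  rw [G.dist_comm, hxy] at hp
  cases p with
  | nil => simp at hp
  | @cons _ z _ hadj q =>
    refine ⟨z, hadj, ?_⟩
    rw [SimpleGraph.Walk.length_cons] at hp
    have h1 := SimpleGraph.dist_le q
    have h2 := hG.dist_triangle (u := x) (v := z) (w := y)
    rw [SimpleGraph.dist_eq_one_iff_adj.2 hadj.symm] at h2
    rw [G.dist_comm] at h1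
    omega

/-- Every distance up to the diameter is attained by an adjacent step. -/
theorem HasIntersectionNumbers.exists_dist_eq (h : HasIntersectionNumbers G bs cs) {i : ℕ}
    (hi : i < G.diam) :
    ∃ x y z, G.Adj y z ∧ G.dist x y = i + 1 ∧ G.dist x z = i := by
  have hdist : ∀ j, j < G.diam → ∃ x y, G.dist x y = G.diam - j := by
    intro j
    induction j with
    | zero =>
      intro _
      have := h.connected.nonempty
      exact G.exists_dist_eq_diam
    | succ j ih =>
      intro hj
      obtain ⟨x, y, hxy⟩ := ih (by omega)
      obtain ⟨z, _, hz⟩ := h.connected.exists_adj_dist_eq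
        (show G.dist x y = (G.diam - (j + 1)) + 1 by omega)
      exact ⟨x, z, hz⟩
  obtain ⟨x, y, hxy⟩ := hdist (G.diam - (i + 1)) (by omega)
  have hxy' : G.dist x y = i + 1 := by omega
  obtain ⟨z, hadj, hz⟩ := h.connected.exists_adj_dist_eq hxy'
  exact ⟨x, y, z, hadj, hxy', hz⟩

theorem HasIntersectionNumbers.bs_pos (h : HasIntersectionNumbers G bs cs) {i : ℕ}
    (hi : i < G.diam) : 0 < bs i := by
  obtain ⟨x, y, z, hadj, hy, hz⟩ := h.exists_dist_eq hi
  rw [← hz, ← h.card_succ x z, Finset.card_pos]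
  exact ⟨y, by simp [hadj.symm, hy, hz]⟩

theorem HasIntersectionNumbers.cs_succ_pos (h : HasIntersectionNumbers G bs cs) {i : ℕ}
    (hi : i < G.diam) : 0 < cs (i + 1) := by
  obtain ⟨x, y, z, hadj, hy, hz⟩ := h.exists_dist_eq hi
  rw [← hy, ← h.card_pred x y, Finset.card_pos]
  exact ⟨z, by simp [hadj, hy, hz]⟩

theorem HasIntersectionNumbers.dist_le_diam (h : HasIntersectionNumbers G bs cs) (x y : V) :
    G.dist x y ≤ G.diam := by
  have := h.connected.nonempty
  exact SimpleGraph.dist_le_diam (SimpleGraph.connected_iff_ediam_ne_top.1 h.connected)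

/-- Extends the classical formula for `b_i`, assumed only below the diameter, to `i = D`, where its
factor `[D] - [i]` is 0. -/
theorem HasIntersectionNumbers.bs_diam (h : HasIntersectionNumbers G bs cs) :
    bs G.diam = 0 := by
  have := h.connected.nonempty
  obtain ⟨x, y, hxy⟩ := G.exists_dist_eq_diam
  rw [← hxy, ← h.card_succ x y, Finset.card_eq_zero, Finset.filter_eq_empty_iff]
  intro z _ hz
  have := h.dist_le_diam x z
  omega

theorem HasIntersectionNumbers.card_common_neighbors_of_adj (h : HasIntersectionNumbers G bs cs)
    {x y : V} (hxy : G.Adj x y) :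
    ((G.neighborFinset x ∩ G.neighborFinset y).card : ℝ) = bs 0 - bs 1 - cs 1 := by
  have h1 := h.card_filter_dist_eq x y
  rw [SimpleGraph.dist_eq_one_iff_adj.2 hxy] at h1
  rw [← h1]
  congr 2
  ext z
  simp [SimpleGraph.dist_eq_one_iff_adj, and_comm]

theorem HasIntersectionNumbers.card_common_neighbors_le (h : HasIntersectionNumbers G bs cs)
    {x y : V} (hne : x ≠ y) (hxy : ¬ G.Adj x y) :
    (G.neighborFinset x ∩ G.neighborFinset y).card ≤ cs 2 := by
  rcases (G.neighborFinset x ∩ G.neighborFinset y).eq_empty_or_nonempty with h0 | ⟨z, hz⟩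
  · simp [h0]
  · have h1 := h.connected.one_lt_dist_of_ne_of_not_adj hne hxy
    rw [Finset.mem_inter, SimpleGraph.mem_neighborFinset, SimpleGraph.mem_neighborFinset] at hz
    have h2 := h.connected.dist_triangle (u := x) (v := z) (w := y)
    rw [SimpleGraph.dist_eq_one_iff_adj.2 hz.1, SimpleGraph.dist_eq_one_iff_adj.2 hz.2.symm] at h2
    have h3 : G.dist x y = 2 := by omega
    rw [← h3, ← h.card_pred x y, h3]
    refine Finset.card_le_card fun w hw => ?_
    rw [Finset.mem_inter, SimpleGraph.mem_neighborFinset] at hw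
    rw [Finset.mem_filter]
    exact ⟨hw.2, by rw [SimpleGraph.dist_eq_one_iff_adj.2 hw.1]⟩

/-- Carries eigenvectors between Euclidean space, where projections live, and plain functions. -/
theorem isSmallestEigenvalue_of_adjEigenspace {t : ℝ} (hne : adjEigenspace G t ≠ ⊥)
    (hmin : ∀ s, adjEigenspace G s ≠ ⊥ → t ≤ s) : IsSmallestEigenvalue G t := by
  constructor
  · obtain ⟨u, hu, hu0⟩ := (Submodule.ne_bot_iff _).1 hne
    rw [mem_adjEigenspace] at hu
    refine Module.End.hasEigenvalue_of_hasEigenvector (x := u.ofLp) ⟨?_, fun h0 => hu0 ?_⟩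
    · rw [Module.End.mem_eigenspace_iff]
      ext x
      simp [SimpleGraph.adjMatrix_mulVec_apply, hu x]
    · ext x
      rw [h0]
      rfl
  · intro s hs
    obtain ⟨u, hu, hu0⟩ := hs.exists_hasEigenvector
    refine hmin s ((Submodule.ne_bot_iff _).2 ⟨WithLp.toLp 2 u, ?_, fun h0 => hu0 ?_⟩)
    · rw [mem_adjEigenspace]
      intro x
      have h1 := congrFun (Module.End.mem_eigenspace_iff.1 hu) x
      rw [Matrix.toLin'_apply, SimpleGraph.adjMatrix_mulVec_apply] at h1
      exact h1
    · exact congrArg WithLp.ofLp h0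

/-- The standard sequence, up to signs, of the smallest eigenvalue of a distance-regular graph with
classical parameters. -/
noncomputable def classicalCosine (b α β : ℝ) : ℕ → ℝ
  | 0 => 1
  | i + 1 => classicalCosine b α β i * ((1 + α * gaussNumber b i) / (β - α * gaussNumber b i))

end Parameters

/-! ### Geometricity of graphs with classical parameters -/

theorem theorem19 {V : Type*} [Fintype V] [DecidableEq V] (G : SimpleGraph V)
    [DecidableRel G.Adj] (D : ℕ) (b α β : ℝ) (hD : 3 ≤ D) (hb : 2 ≤ b)
    (hG : HasClassicalParameters G D b α β)
    (hβ : max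
        ((2 * b + 4) / (2 * b + 3) * gaussNumber b D * (b + 2) * (α * b + b + α))
        ((2 * b + 4) / (2 * b + 3) * gaussNumber b D * ((b + 1) * (b ^ 2 + b + 2) - 3)) ≤ β) :
    IsGeometric G := by
  obtain ⟨rfl, bs, cs, h, hbs, hcs⟩ := hG
  refine ⟨⟨bs, cs, h⟩, ?_⟩
  set g := gaussNumber b with hg
  have hg0 : g 0 = 0 := gaussNumber_zero
  have hg1 : g 1 = 1 := by rw [hg, gaussNumber_succ hb, gaussNumber_zero]; ring
  have hg2 : g 2 = b + 1 := by
    have := gaussNumber_succ hb 1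
    rw [← hg, hg1] at this
    rw [this]
    ring
  have hα : ∀ i, i < G.diam → 0 < 1 + α * g i := by
    intro i hi
    have h1 := hcs (i + 1) (by omega) hi
    rw [Nat.add_sub_cancel] at h1
    have h2 : (0 : ℝ) < cs (i + 1) := Nat.cast_pos.2 (h.cs_succ_pos hi)
    rw [h1] at h2
    exact pos_of_mul_pos_right h2 (gaussNumber_nonneg hb _)
  have hβα : ∀ i, i < G.diam → 0 < β - α * g i := by
    intro i hi
    have h2 : (0 : ℝ) < bs i := Nat.cast_pos.2 (h.bs_pos hi)
    rw [hbs i hi] at h2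
    exact pos_of_mul_pos_right h2 (sub_nonneg.2 (gaussNumber_strictMono hb hi).le)
  obtain ⟨n, hn⟩ := Nat.exists_eq_succ_of_ne_zero (show G.diam ≠ 0 by omega)
  have hp : b + 1 ≤ g n := by
    rw [← hg2]
    exact (gaussNumber_strictMono hb).monotone (by omega)
  have hr : g G.diam = 1 + b * g n := by rw [hn]; exact gaussNumber_succ hb n
  -- Positivity of `c_D` and `c_3` gives these two signs; the latter needs `D ≥ 3`. Negative `α` is
  -- thereby allowed.
  have hαn := hα n (by omega)
  have hα2 := hα 2 (by omega)
  rw [hg2] at hα2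
  obtain ⟨hbig, hQ, hQ2⟩ := classical_parameter_bounds hb hr hp hαn hα2
    ((le_max_left _ _).trans hβ) ((le_max_right _ _).trans hβ)
  set r := g G.diam with hrdef
  have hr7 : 7 ≤ r := by nlinarith
  have hβ0 : 0 < β := by simpa [hg0] using hβα 0 (by omega)
  have hβ1 : 1 < β := by nlinarith
  have hk : (bs 0 : ℝ) = r * β := by rw [hbs 0 (by omega), hg0]; ring
  have hb1 : (bs 1 : ℝ) = (r - 1) * (β - α) := by rw [hbs 1 (by omega), hg1]; ring
  have hc1 : (cs 1 : ℝ) = 1 := by rw [hcs 1 le_rfl (by omega), hg1, hg0]; ring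
  have hc2 : (cs 2 : ℝ) = (b + 1) * (1 + α) := by
    rw [hcs 2 (by omega) (by omega), hg2, hg1, mul_one]
  have hbs' : ∀ i, i ≤ G.diam → (bs i : ℝ) = (r - g i) * (β - α * g i) := by
    intro i hi
    rcases hi.lt_or_eq with hi | rfl
    · exact hbs i hi
    · rw [h.bs_diam, ← hrdef, sub_self, zero_mul, Nat.cast_zero]
  have hv : ∀ i, i ≤ G.diam → 0 < classicalCosine b α β i := by
    intro i
    induction i with
    | zero => intro _; exact one_pos
    | succ i ih =>
      intro hi
      exact mul_pos (ih (by omega)) (div_pos (hα i hi) (hβα i hi))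
  have hstep : ∀ i, i < G.diam → (β - α * g i) * classicalCosine b α β (i + 1) =
      (1 + α * g i) * classicalCosine b α β i := by
    intro i hi
    have := (hβα i hi).ne'
    rw [classicalCosine, ← hg]
    field_simp
  have hrec : ∀ x y, cs (G.dist x y) * classicalCosine b α β (G.dist x y - 1) +
      bs (G.dist x y) * classicalCosine b α β (G.dist x y + 1) =
      (bs 0 - bs (G.dist x y) - cs (G.dist x y) + r) * classicalCosine b α β (G.dist x y) := by
    intro x y
    have hi := h.dist_le_diam x y
    generalize G.dist x y = i at hi
    have hup : bs i * classicalCosine b α β (i + 1) =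
        (r - g i) * (1 + α * g i) * classicalCosine b α β i := by
      rcases hi.lt_or_eq with hi | rfl
      · rw [hbs i hi, mul_assoc, hstep i hi]
        ring
      · rw [h.bs_diam, ← hrdef]
        simp
    rw [hup, hk, hbs' i hi]
    cases i with
    | zero => rw [h.cs_zero, hg0]; push_cast; ring
    | succ j =>
      rw [Nat.add_sub_cancel, hcs (j + 1) (by omega) hi, Nat.add_sub_cancel]
      linear_combination -(g (j + 1)) * hstep j hi
  have hmin : ∀ t, adjEigenspace G t ≠ ⊥ → -r ≤ t := fun t ht =>
    h.neg_le_eigenvalue (by linarith) (fun x y => hv _ (h.dist_le_diam x y)) hrec ht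
  have hne : adjEigenspace G (-r) ≠ ⊥ := h.adjEigenspace_neg_ne_bot (hv 0 (Nat.zero_le _)).ne' hrec
  obtain ⟨x₀, y₀, z₀, hadj₀, -, -⟩ := h.exists_dist_eq (show 0 < G.diam by omega)
  obtain ⟨lam, hlam₀⟩ : ∃ lam, (G.neighborFinset y₀ ∩ G.neighborFinset z₀).card = lam := ⟨_, rfl⟩
  have hlamR : (lam : ℝ) = bs 0 - bs 1 - cs 1 := by
    rw [← hlam₀, h.card_common_neighbors_of_adj hadj₀]
  have hlam : ∀ x y, G.Adj x y → (G.neighborFinset x ∩ G.neighborFinset y).card = lam := by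
    intro x y hxy
    have := h.card_common_neighbors_of_adj hxy
    rw [← hlamR] at this
    exact_mod_cast this
  have hQeq : (lam : ℝ) + 2 - cs 2 = β + α * (r - 1) - (α * b + b + α) := by
    rw [hlamR, hk, hb1, hc1, hc2]
    ring
  obtain ⟨𝓛, h𝓛, huniq⟩ := exists_lines (G := G) (k := bs 0) (lam := lam) (μ := cs 2)
    h.isRegularOfDegree hlam (fun x y hne hxy => h.card_common_neighbors_le hne hxy)
    (by
      have : (cs 2 : ℝ) < lam + 2 := by linarith
      exact_mod_cast this)
    (by
      have h1 : (bs 0 : ℝ) - 1 - lam = (r - 1) * (β - α) := by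
        rw [hlamR, hb1, hc1]
        ring
      have h2 : (cs 2 : ℝ) - 1 = α * b + b + α := by
        rw [hc2]
        ring
      rw [← hQeq, ← h1, ← h2] at hQ2
      exact_mod_cast hQ2)
  have hcard := h.card_line_eq (by linarith) hβ1 hk hbig hmin hne (fun L hL => (h𝓛 L hL).1)
    (fun L hL => by
      have h1 : (lam : ℝ) + 2 + cs 2 < 2 * L.card := by exact_mod_cast (h𝓛 L hL).2
      -- The excess over `β + 1` is a sum of two terms, positive by `hαn` and `hα2`.
      have h2 : (lam : ℝ) + 2 + cs 2 = β + 1 + b * (1 + α * g n) + (1 + α * (b + 1)) := by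
        rw [hlamR, hk, hb1, hc1, hc2, hr]
        ring
      have h3 : 0 < b * (1 + α * g n) := mul_pos (by linarith) hαn
      linarith) huniq
  refine ⟨(𝓛 : Set (Finset V)), fun C hC => ⟨(h𝓛 C hC).1, bs 0, -r, h.isRegularOfDegree,
    isSmallestEigenvalue_of_adjEigenspace hne hmin, ?_⟩, huniq⟩
  rw [hcard C hC, hk, neg_neg, mul_div_cancel_left₀ _ (by linarith)]
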